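/- \textbf{Theorem (Validity).} Let $n=3f+1$ participants run the EByFTVeS consensus protocol described below, and let at most $f$ of them be Byzantine. Then in every execution all honest participants agree on the sequence numbers of the requests that they commit locally. That is, if honest participants $p_i,p_j$ commit batches $b,b'$ locally with the same sequence number $sq$, in views $v,v'$ (equal or different), then $h(b)=h(b')$, where $h$ is the protocol's hash function; consequently, if $h$ has no collisions, then $b=b'$. Moreover, if $h$ has no collisions and a request belongs both to a batch that $p_i$ commits locally with sequence number $sq$ and to a batch that $p_j$ commits locally with sequence number $sq'$, then $sq=sq'$. \textbf{The protocol (PBFT with a Pre-Propose phase; no checkpointing or garbage collection).} Messages are signed and signatures cannot be forged; the hash function $h$ maps batches, i.e. finite sets of requests, to digests. Every view $v=0,1,2,\dots$ has a designated primary. The network is asynchronous: it may delay, reorder, duplicate or drop messages. Byzantine participants collude, see all messages, and send arbitrary messages, but cannot produce messages signed by honest participants that these have not sent. Honest participants start in view $0$; while in view $v$ they may do the following. \begin{itemize} \item \emph{Request.} Broadcast a signed $\langle\mathrm{REQUEST},v,sq,req\rangle$; a request is such a signed message, including $v$ and $sq$. \item \emph{Pre-Propose.} Having received at least a fixed number $batch\_size$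 of requests for $(v,sq)$ from distinct participants, send them as an initial proposal for $(v,sq)$. \item \emph{Pre-Prepare.} The primary, having received more than $2f$ valid initial proposals for $(v,sq)$ from distinct participants, aggregates them into the batch of all requests that appear in more than $f$ of them, and broadcasts the digest of the batch together with the signed initial proposals. \item \emph{Prepare.} On a valid Pre-Prepare for $(v,sq)$ from the primary, whose digest $\delta$ is checked by recomputing the batch, and if no digest has been accepted yet for $(v,sq)$: accept $\delta$ and broadcast $\langle\mathrm{PREPARE},v,sq,\delta\rangle$. \item \emph{Commit.} On $2f+1$ matching $\langle\mathrm{PREPARE},v,sq,\delta\rangle$, or on $f+1$ matching $\langle\mathrm{COMMIT},v,sq,\delta\rangle$, broadcast $\langle\mathrm{COMMIT},v,sq,\delta\rangle$ and store these messages as a certificate for $(v,sq,\delta)$. \item \emph{Local commit.} On $2f+1$ matching $\langle\mathrm{COMMIT},v'',sq,\delta\rangle$ with $v''\le v$, commit locally in view $v''$, with sequence number $sq$, a batch $b$ with $h(b)=\delta$, and store a certificate. \item \emph{View change.} At any time (e.g. after a timeout) stop taking part in view $v$ and broadcast a View-change message for some view $w>v$ containing all stored certificates; until a valid New-view message is received,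 only requests, local commits, a further view change and, by the primary, the New-view message are possible. A View-change message for $w$ is valid if all its certificates are valid ($2f+1$ matching Prepare or $f+1$ matching Commit messages) and from views before $w$. \item \emph{New view.} The primary of $w$, having received at least $2f+1$ valid View-change messages for $w$ from distinct participants, broadcasts a New-view message with these messages and, for every sequence number $sq$ up to the largest one with a certificate in them, the digest of a certificate for $sq$ of highest view among them, or $h(\emptyset)$ (the null request) if they contain no certificate for $sq$. A participant that has not yet entered $w$ or a later view, nor asked for a view later than $w$, may verify this message and then enter view $w$, accept these digests for $w$, and broadcast the corresponding Prepare messages; other sequence numbers follow the normal case above. \end{itemize} -/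

import Mathlib

/-!
The EByFTVeS consensus protocol: PBFT with a Pre-Propose phase in front of Pre-Prepare, Prepare
and Commit, together with PBFT's view change, as an asynchronous transition system with Byzantine
participants.  `P` is the type of participants, `R` the type of request contents, `D` the type of
digests.  Views and sequence numbers are natural numbers.

Signatures are ideal: a message carries its signer, and a message signed by an honest participant
exists only if this participant has sent it.
-/

namespace EByFTVeS

/-- `⟨REQUEST, view, sq, req⟩` signed by `sender`. -/
structure Request (P R : Type*) where
  sender : P
  view : ℕ
  sq : ℕ
  req : R

/-- Proposals are finite sets of requests. -/
abbrev Batch (P R : Type*) := Finset (Request P R)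

/-- `⟨PRE-PROPOSE, view, sq, prop⟩` signed by `sender`. -/
structure PrePropose (P R : Type*) where
  sender : P
  view : ℕ
  sq : ℕ
  prop : Batch P R

/-- `⟨PRE-PREPARE, view, sq, digest, raw⟩` signed by `sender`; `raw` are the signed initial
proposals from which the batch with the given digest was aggregated. -/
structure PrePrepare (P R D : Type*) where
  sender : P
  view : ℕ
  sq : ℕ
  digest : D
  raw : Finset (PrePropose P R)

/-- The two voting phases. -/
inductive Phase where
  | prepare
  | commit

/-- `⟨PREPARE, view, sq, digest⟩` or `⟨COMMIT, view, sq, digest⟩` signed by `sender`. -/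
structure Vote (P D : Type*) where
  phase : Phase
  sender : P
  view : ℕ
  sq : ℕ
  digest : D

/-- A certificate: matching Prepare (or matching Commit) messages, one signed by each of `signers`.
-/
structure Certificate (P D : Type*) where
  phase : Phase
  view : ℕ
  sq : ℕ
  digest : D
  signers : Finset P

/-- `⟨VIEW-CHANGE, view, certs⟩` signed by `sender`, where `view` is the view to be entered. -/
structure ViewChange (P D : Type*) where
  sender : P
  view : ℕ
  certs : Finset (Certificate P D)

/-- `⟨NEW-VIEW, view, V, O⟩` signed by `sender`.  The list `O` holds the digests that are proposed
again in the new view: its entry with index `sq` belongs to the sequence number `sq`. -/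
structure NewView (P D : Type*) where
  sender : P
  view : ℕ
  V : Finset (ViewChange P D)
  O : List D

/-- Messages. -/
inductive Msg (P R D : Type*) where
  | request (m : Request P R)
  | prePropose (m : PrePropose P R)
  | prePrepare (m : PrePrepare P R D)
  | vote (m : Vote P D)
  | viewChange (m : ViewChange P D)
  | newView (m : NewView P D)

section Messages

variable {P R D : Type*}

/-- The signed votes of which a certificate consists. -/
def Certificate.votes (c : Certificate P D) : Set (Vote P D) :=
  {x | ∃ j ∈ c.signers, x = ⟨c.phase, j, c.view, c.sq, c.digest⟩}

/-- The signer of a message. -/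
def Msg.sender : Msg P R D → P
  | .request m => m.sender
  | .prePropose m => m.sender
  | .prePrepare m => m.sender
  | .vote m => m.sender
  | .viewChange m => m.sender
  | .newView m => m.sender

/-- All signed messages contained, at any depth, in a message. -/
def Msg.embedded : Msg P R D → Set (Msg P R D)
  | .request _ => ∅
  | .prePropose m => {x | ∃ r ∈ m.prop, x = .request r}
  | .prePrepare m =>
      {x | ∃ p ∈ m.raw, x = .prePropose p ∨ ∃ r ∈ p.prop, x = .request r}
  | .vote _ => ∅
  | .viewChange m => {x | ∃ c ∈ m.certs, ∃ y ∈ c.votes, x = .vote y}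
  | .newView m =>
      {x | ∃ w ∈ m.V, x = .viewChange w ∨ ∃ c ∈ w.certs, ∃ y ∈ c.votes, x = .vote y}

end Messages

/-- The public parameters: the fault bound `f`, the minimal size `batchSize` of an initial
proposal, the primary of each view, and the hash function `h`. -/
structure Config (P R D : Type*) where
  f : ℕ
  batchSize : ℕ
  primary : ℕ → P
  h : Batch P R → D

section Checks

variable {P R D : Type*}

open Classical in
/-- The requests that appear in more than `f` of the given initial proposals. -/
noncomputable def aggregate (f : ℕ) (raw : Finset (PrePropose P R)) : Batch P R :=
  (raw.biUnion PrePropose.prop).filter fun r => f < (raw.filter fun p => r ∈ p.prop).card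

/-- A valid initial proposal holds at least `batchSize` requests for its view and sequence number,
at most one from each participant. -/
def PrePropose.Valid (cfg : Config P R D) (m : PrePropose P R) : Prop :=
  (∀ r ∈ m.prop, r.view = m.view ∧ r.sq = m.sq) ∧
  Set.InjOn Request.sender (m.prop : Set (Request P R)) ∧
  cfg.batchSize ≤ m.prop.card

/-- A set of more than `2f` valid initial proposals for `(v, sq)` from distinct participants. -/
def ValidRaw (cfg : Config P R D) (v sq : ℕ) (raw : Finset (PrePropose P R)) : Prop :=
  (∀ p ∈ raw, p.Valid cfg ∧ p.view = v ∧ p.sq = sq) ∧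
  Set.InjOn PrePropose.sender (raw : Set (PrePropose P R)) ∧
  2 * cfg.f < raw.card

/-- A valid Pre-Prepare message comes from the primary of its view, and its digest is that of the
batch recomputed from the attached initial proposals. -/
def PrePrepare.Valid (cfg : Config P R D) (m : PrePrepare P R D) : Prop :=
  m.sender = cfg.primary m.view ∧
  ValidRaw cfg m.view m.sq m.raw ∧
  m.digest = cfg.h (aggregate cfg.f m.raw)

/-- A valid certificate: `2f + 1` matching Prepare messages (the request is prepared), or `f + 1`
matching Commit messages. -/
def Certificate.Valid (cfg : Config P R D) (c : Certificate P D) : Prop :=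
  match c.phase with
  | .prepare => 2 * cfg.f + 1 ≤ c.signers.card
  | .commit => cfg.f + 1 ≤ c.signers.card

/-- A valid View-change message carries valid certificates from earlier views only. -/
def ViewChange.Valid (cfg : Config P R D) (m : ViewChange P D) : Prop :=
  ∀ c ∈ m.certs, c.Valid cfg ∧ c.view < m.view

/-- At least `2f + 1` valid View-change messages for view `v` from distinct participants. -/
def ValidViewChanges (cfg : Config P R D) (v : ℕ) (V : Finset (ViewChange P D)) : Prop :=
  (∀ w ∈ V, w.Valid cfg ∧ w.view = v) ∧
  Set.InjOn ViewChange.sender (V : Set (ViewChange P D)) ∧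
  2 * cfg.f + 1 ≤ V.card

/-- The certificate `c` occurs in one of the View-change messages in `V`. -/
def Reported (V : Finset (ViewChange P D)) (c : Certificate P D) : Prop :=
  ∃ w ∈ V, c ∈ w.certs

/-- `O` is computed correctly from `V`.  It covers the sequence numbers up to the largest one for
which `V` reports a certificate; a sequence number with a reported certificate keeps the digest of
a reported certificate of highest view, and a gap is filled with the null request, that is, with
the empty batch. -/
def CarryForward (cfg : Config P R D) (V : Finset (ViewChange P D)) (O : List D) : Prop :=
  (∀ sq, sq < O.length ↔ ∃ c, Reported V c ∧ sq ≤ c.sq) ∧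
  ∀ sq δ, O[sq]? = some δ →
    (∃ c, Reported V c ∧ c.sq = sq ∧ c.digest = δ ∧
      ∀ c', Reported V c' → c'.sq = sq → c'.view ≤ c.view) ∨
    ((∀ c, Reported V c → c.sq ≠ sq) ∧ δ = cfg.h ∅)

/-- A valid New-view message. -/
def NewView.Valid (cfg : Config P R D) (m : NewView P D) : Prop :=
  m.sender = cfg.primary m.view ∧
  ValidViewChanges cfg m.view m.V ∧
  CarryForward cfg m.V m.O

end Checks

/-- The state of a participant.  `active` is false between the moment the participant asks for
`view` and the moment it receives a valid New-view message for `view`.  `accepted v sq` is the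
digest accepted for view `v` and sequence number `sq`, if any.  `certs` are the certificates of
the requests for which the participant reached the Commit phase or committed; `committed` holds
the `(v, sq, batch)` with `committed-local(h(batch), v, sq) = true`. -/
structure LocalState (P R D : Type*) where
  view : ℕ
  active : Bool
  received : Set (Msg P R D)
  accepted : ℕ → ℕ → Option D
  certs : Finset (Certificate P D)
  committed : Set (ℕ × ℕ × Batch P R)

section Protocol

variable {P R D : Type*}

/-- The initial state of a participant. -/
def LocalState.init : LocalState P R D where
  view := 0
  active := true
  received := ∅
  accepted := fun _ _ => none
  certs := ∅
  committed := ∅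

/-- The participant has received the votes of which the certificate `c` consists. -/
def LocalState.Holds (l : LocalState P R D) (c : Certificate P D) : Prop :=
  ∀ y ∈ c.votes, Msg.vote y ∈ l.received

open Classical in
/-- `HonestStep cfg i l l' out`: an honest participant `i` in state `l` can move to the state `l'`
while broadcasting the messages in `out`. -/
inductive HonestStep (cfg : Config P R D) (i : P) :
    LocalState P R D → LocalState P R D → Set (Msg P R D) → Prop
  /-- `broadcast_update(sq, req)`. -/
  | broadcastUpdate (l : LocalState P R D) (sq : ℕ) (req : R) :
      HonestStep cfg i l l {.request ⟨i, l.view, sq, req⟩}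
  /-- Pre-Propose: bundle received requests. -/
  | prePropose (l : LocalState P R D) (sq : ℕ) (prop : Batch P R) :
      l.active = true →
      (∀ r ∈ prop, Msg.request r ∈ l.received) →
      PrePropose.Valid cfg ⟨i, l.view, sq, prop⟩ →
      HonestStep cfg i l l {.prePropose ⟨i, l.view, sq, prop⟩}
  /-- Pre-Prepare: the primary aggregates the initial proposals. -/
  | prePrepare (l : LocalState P R D) (sq : ℕ) (raw : Finset (PrePropose P R)) :
      l.active = true →
      i = cfg.primary l.view →
      (∀ p ∈ raw, Msg.prePropose p ∈ l.received) →
      ValidRaw cfg l.view sq raw →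
      HonestStep cfg i l l
        {.prePrepare ⟨i, l.view, sq, cfg.h (aggregate cfg.f raw), raw⟩}
  /-- Prepare: accept a valid Pre-Prepare message for the current view, unless a digest has been
  accepted already for this view and sequence number. -/
  | prepare (l : LocalState P R D) (m : PrePrepare P R D) :
      l.active = true →
      Msg.prePrepare m ∈ l.received →
      m.Valid cfg →
      m.view = l.view →
      l.accepted l.view m.sq = none →
      HonestStep cfg i l
        { l with accepted := fun v sq =>
            if v = l.view ∧ sq = m.sq then some m.digest else l.accepted v sq }
        {.vote ⟨.prepare, i, l.view, m.sq, m.digest⟩}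
  /-- Commit: on a valid certificate of the current view (`2f + 1` matching Prepare messages, or
  `f + 1` matching Commit messages), broadcast the matching Commit message. -/
  | commit (l : LocalState P R D) (c : Certificate P D) :
      l.active = true →
      c.view = l.view →
      c.Valid cfg →
      l.Holds c →
      HonestStep cfg i l { l with certs := insert c l.certs }
        {.vote ⟨.commit, i, l.view, c.sq, c.digest⟩}
  /-- Commit locally: on `2f + 1` matching Commit messages for the digest of `batch`. -/
  | commitLocal (l : LocalState P R D) (c : Certificate P D) (batch : Batch P R) :
      c.view ≤ l.view →
      c.phase = .commit →
      2 * cfg.f + 1 ≤ c.signers.card →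
      l.Holds c →
      cfg.h batch = c.digest →
      HonestStep cfg i l
        { l with
          certs := insert c l.certs
          committed := insert (c.view, c.sq, batch) l.committed } ∅
  /-- View change (for instance after a timeout): leave the current view for a later view `v` and
  report all certificates. -/
  | viewChange (l : LocalState P R D) (v : ℕ) :
      l.view < v →
      HonestStep cfg i l { l with view := v, active := false }
        {.viewChange ⟨i, v, l.certs⟩}
  /-- The primary of the view that is being established announces it. -/
  | announceNewView (l : LocalState P R D) (V : Finset (ViewChange P D)) (O : List D) :
      l.active = false →
      i = cfg.primary l.view →
      (∀ w ∈ V, Msg.viewChange w ∈ l.received) →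
      ValidViewChanges cfg l.view V →
      CarryForward cfg V O →
      HonestStep cfg i l l {.newView ⟨i, l.view, V, O⟩}
  /-- Enter a view by a valid New-view message: accept the digests carried forward and broadcast
  the Prepare messages for them. -/
  | enterNewView (l : LocalState P R D) (m : NewView P D) :
      Msg.newView m ∈ l.received →
      m.Valid cfg →
      (l.view < m.view ∨ (l.view = m.view ∧ l.active = false)) →
      HonestStep cfg i l
        { l with
          view := m.view
          active := true
          accepted := fun v sq => if v = m.view then m.O[sq]? else l.accepted v sq }
        {x | ∃ sq δ, m.O[sq]? = some δ ∧ x = .vote ⟨.prepare, i, m.view, sq, δ⟩}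

/-- A global state: the messages sent so far and the states of the participants (those of
Byzantine participants play no role). -/
structure State (P R D : Type*) where
  sent : Set (Msg P R D)
  loc : P → LocalState P R D

/-- The initial global state. -/
def State.init : State P R D where
  sent := ∅
  loc := fun _ => LocalState.init

open Classical in
/-- The steps of the system in which exactly the participants in `B` are Byzantine. -/
inductive Step (cfg : Config P R D) (B : Finset P) : State P R D → State P R D → Prop
  /-- An honest participant follows the protocol. -/
  | honest (s : State P R D) (i : P) (l : LocalState P R D) (out : Set (Msg P R D)) :
      i ∉ B →
      HonestStep cfg i (s.loc i) l out →
      Step cfg B s ⟨s.sent ∪ out, Function.update s.loc i l⟩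
  /-- The network delivers a message; it may delay, reorder, duplicate or drop messages. -/
  | deliver (s : State P R D) (i : P) (m : Msg P R D) :
      m ∈ s.sent →
      Step cfg B s ⟨s.sent, Function.update s.loc i
        { s.loc i with received := insert m (s.loc i).received }⟩
  /-- A Byzantine participant sends an arbitrary message under its own name.  It knows all
  messages sent so far, but it cannot forge messages signed by honest participants. -/
  | byzantine (s : State P R D) (m : Msg P R D) :
      m.sender ∈ B →
      (∀ x ∈ m.embedded, x.sender ∉ B → x ∈ s.sent) →
      Step cfg B s ⟨insert m s.sent, s.loc⟩

/-- The states that occur in executions of the protocol. -/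
def Reachable (cfg : Config P R D) (B : Finset P) (s : State P R D) : Prop :=
  Relation.ReflTransGen (Step cfg B) State.init s

/-- In state `s`, participant `i` has committed `batch` locally with sequence number `sq` in
view `v`. -/
def State.CommittedLocal (s : State P R D) (i : P) (v sq : ℕ) (batch : Batch P R) : Prop :=
  (v, sq, batch) ∈ (s.loc i).committed

end Protocol

end EByFTVeS

/-! Any two sets of `2f + 1` among `3f + 1` participants share an honest one. An honest participant
prepares at most one digest per view and sequence number, so two digests cannot both have a Prepare
quorum there. An honest Commit always rests on a Prepare quorum: if it was triggered by `f + 1`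
Commits, one of these is honest and earlier.

Across views (`Inv.digest_eq_of_le`), suppose a quorum has sent Commits for `δ` in view `v`. The
View-change quorum behind any valid New-view message for `w > v` meets it in an honest participant,
which reports `δ` from view `v`. So the list of digests has an entry for this sequence number, taken
from a reported certificate whose view lies in `[v, w)`. That certificate witnesses a Prepare
quorum, and strong induction on `w` identifies its digest with `δ`. The local facts used here form
an invariant, preserved by `HonestStep.localInv` and `Step.inv`.

For the claim on requests, a prepared digest is traced back through New-view messages to an
aggregate, whose requests carry the sequence number, or to the null request
(`Inv.sq_eq_of_prepared`). -/

namespace EByFTVeS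

section Safety

variable {P R D : Type*}

/-! ### Quorums and announcements -/

/-- A set of `2f + 1` participants whose honest members have all sent the given Prepare message. -/
def PrepareQuorum (cfg : Config P R D) (B : Finset P) (sent : Set (Msg P R D))
    (v sq : ℕ) (δ : D) : Prop :=
  ∃ S : Finset P, 2 * cfg.f + 1 ≤ S.card ∧
    ∀ k ∈ S, k ∉ B → Msg.vote ⟨.prepare, k, v, sq, δ⟩ ∈ sent

/-- A set of `2f + 1` participants who have all sent the given Commit message. -/
def CommitQuorum (cfg : Config P R D) (sent : Set (Msg P R D)) (v sq : ℕ) (δ : D) : Prop :=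
  ∃ S : Finset P, 2 * cfg.f + 1 ≤ S.card ∧
    ∀ k ∈ S, Msg.vote ⟨.commit, k, v, sq, δ⟩ ∈ sent

/-- A valid New-view message for `v` has been sent whose list of digests satisfies `p`. -/
def Announced (cfg : Config P R D) (sent : Set (Msg P R D)) (v : ℕ) (p : List D → Prop) : Prop :=
  ∃ m : NewView P D, Msg.newView m ∈ sent ∧ m.Valid cfg ∧ m.view = v ∧ p m.O

/-- The messages embedded in sent messages cannot be forged. -/
def Unforged (B : Finset P) (sent : Set (Msg P R D)) : Prop :=
  ∀ m ∈ sent, ∀ x ∈ m.embedded, x.sender ∉ B → x ∈ sent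

variable {cfg : Config P R D} {B : Finset P} {sent sent' : Set (Msg P R D)}

theorem PrepareQuorum.mono {v sq : ℕ} {δ : D} (h : PrepareQuorum cfg B sent v sq δ)
    (hs : sent ⊆ sent') : PrepareQuorum cfg B sent' v sq δ := by
  obtain ⟨S, hS, h⟩ := h
  exact ⟨S, hS, fun k hk hkB => hs (h k hk hkB)⟩

theorem CommitQuorum.mono {v sq : ℕ} {δ : D} (h : CommitQuorum cfg sent v sq δ)
    (hs : sent ⊆ sent') : CommitQuorum cfg sent' v sq δ := by
  obtain ⟨S, hS, h⟩ := h
  exact ⟨S, hS, fun k hk => hs (h k hk)⟩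

theorem Announced.mono {v : ℕ} {p : List D → Prop} (h : Announced cfg sent v p)
    (hs : sent ⊆ sent') : Announced cfg sent' v p := by
  obtain ⟨m, hm, h⟩ := h
  exact ⟨m, hs hm, h⟩

/-! ### The invariant of one honest participant -/

/-- What holds of an honest participant `i` in local state `l` when `sent` are the messages sent. -/
structure LocalInv (cfg : Config P R D) (B : Finset P) (sent : Set (Msg P R D)) (i : P)
    (l : LocalState P R D) : Prop where
  received_sent : l.received ⊆ sent
  certs_held : ∀ c ∈ l.certs, l.Holds c
  -- The clause on `active` says that no Prepare is sent in a view that has been asked for but not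
  -- entered, so entering it may overwrite `accepted`.
  prepare_accepted : ∀ v sq δ, Msg.vote ⟨.prepare, i, v, sq, δ⟩ ∈ sent →
    v ≤ l.view ∧ (v = l.view → l.active = true) ∧ l.accepted v sq = some δ
  -- View `0` has no New-view message. A Byzantine primary may announce several lists, so only some
  -- message is claimed; its list may lack an entry at `sq` if the digest came by a Pre-Prepare.
  prepare_announced : ∀ v sq δ, Msg.vote ⟨.prepare, i, v, sq, δ⟩ ∈ sent → 0 < v →
    Announced cfg sent v fun O => ∀ δ', O[sq]? = some δ' → δ' = δ
  prepare_origin : ∀ v sq δ, Msg.vote ⟨.prepare, i, v, sq, δ⟩ ∈ sent →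
    (∃ raw, ValidRaw cfg v sq raw ∧ δ = cfg.h (aggregate cfg.f raw)) ∨
      Announced cfg sent v fun O => O[sq]? = some δ
  active_announced : l.active = true → 0 < l.view →
    Announced cfg sent l.view fun O => ∀ sq δ, O[sq]? = some δ → l.accepted l.view sq = some δ
  commit_quorum : ∀ v sq δ, Msg.vote ⟨.commit, i, v, sq, δ⟩ ∈ sent →
    PrepareQuorum cfg B sent v sq δ
  commit_certified : ∀ v sq δ, Msg.vote ⟨.commit, i, v, sq, δ⟩ ∈ sent →
    v ≤ l.view ∧ ∃ c ∈ l.certs, c.view = v ∧ c.sq = sq ∧ c.digest = δ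
  viewChange_reports : ∀ w C, Msg.viewChange ⟨i, w, C⟩ ∈ sent → w ≤ l.view ∧
    ∀ v sq δ, Msg.vote ⟨.commit, i, v, sq, δ⟩ ∈ sent → v < w →
      ∃ c ∈ C, c.view = v ∧ c.sq = sq ∧ c.digest = δ
  committed_quorum : ∀ v sq b, (v, sq, b) ∈ l.committed → CommitQuorum cfg sent v sq (cfg.h b)

theorem LocalInv.init (cfg : Config P R D) (B : Finset P) (i : P) :
    LocalInv cfg B ∅ i LocalState.init := by
  constructor <;> simp [LocalState.init]

/-- Messages of other participants do not affect the invariant of `i`. -/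
theorem LocalInv.mono {i : P} {l : LocalState P R D} (h : LocalInv cfg B sent i l)
    (hs : sent ⊆ sent') (hi : ∀ m ∈ sent', m.sender = i → m ∈ sent) :
    LocalInv cfg B sent' i l where
  received_sent := h.received_sent.trans hs
  certs_held := h.certs_held
  prepare_accepted v sq δ hm := h.prepare_accepted v sq δ (hi _ hm rfl)
  prepare_announced v sq δ hm hv := (h.prepare_announced v sq δ (hi _ hm rfl) hv).mono hs
  prepare_origin v sq δ hm := (h.prepare_origin v sq δ (hi _ hm rfl)).imp_right fun a => a.mono hs
  active_announced ha hv := (h.active_announced ha hv).mono hs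
  commit_quorum v sq δ hm := (h.commit_quorum v sq δ (hi _ hm rfl)).mono hs
  commit_certified v sq δ hm := h.commit_certified v sq δ (hi _ hm rfl)
  viewChange_reports w C hm := ⟨(h.viewChange_reports w C (hi _ hm rfl)).1, fun v sq δ hv hlt =>
    (h.viewChange_reports w C (hi _ hm rfl)).2 v sq δ (hi _ hv rfl) hlt⟩
  committed_quorum v sq b hb := (h.committed_quorum v sq b hb).mono hs

theorem LocalInv.deliver {i : P} {l : LocalState P R D} (h : LocalInv cfg B sent i l)
    {m : Msg P R D} (hm : m ∈ sent) :
    LocalInv cfg B sent i { l with received := insert m l.received } :=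
  { h with
    received_sent := Set.insert_subset hm h.received_sent
    certs_held := fun c hc y hy => Or.inr (h.certs_held c hc y hy) }

theorem HonestStep.sender_eq {i : P} {l l' : LocalState P R D} {out : Set (Msg P R D)}
    (h : HonestStep cfg i l l' out) : ∀ m ∈ out, m.sender = i := by
  cases h <;> simp_all [Msg.sender]

/-- Sending a message that is neither a vote nor a View-change message. -/
theorem LocalInv.send {i : P} {l : LocalState P R D} (h : LocalInv cfg B sent i l)
    {m : Msg P R D} (h1 : ∀ y, m ≠ .vote y) (h2 : ∀ y, m ≠ .viewChange y) :
    LocalInv cfg B (sent ∪ {m}) i l := by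
  have hs : sent ⊆ sent ∪ {m} := Set.subset_union_left
  have hv : ∀ y, Msg.vote y ∈ sent ∪ {m} → Msg.vote y ∈ sent := fun y hy =>
    hy.resolve_right fun e => h1 y e.symm
  have hw : ∀ y, Msg.viewChange y ∈ sent ∪ {m} → Msg.viewChange y ∈ sent := fun y hy =>
    hy.resolve_right fun e => h2 y e.symm
  exact
  { received_sent := h.received_sent.trans hs
    certs_held := h.certs_held
    prepare_accepted := fun v sq δ hm => h.prepare_accepted v sq δ (hv _ hm)
    prepare_announced := fun v sq δ hm hv' => (h.prepare_announced v sq δ (hv _ hm) hv').mono hs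
    prepare_origin := fun v sq δ hm =>
      (h.prepare_origin v sq δ (hv _ hm)).imp_right fun a => a.mono hs
    active_announced := fun ha hv' => (h.active_announced ha hv').mono hs
    commit_quorum := fun v sq δ hm => (h.commit_quorum v sq δ (hv _ hm)).mono hs
    commit_certified := fun v sq δ hm => h.commit_certified v sq δ (hv _ hm)
    viewChange_reports := fun w C hm => ⟨(h.viewChange_reports w C (hw _ hm)).1,
      fun v sq δ hm' hlt => (h.viewChange_reports w C (hw _ hm)).2 v sq δ (hv _ hm') hlt⟩
    committed_quorum := fun v sq b hb => (h.committed_quorum v sq b hb).mono hs }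

/-! ### Preservation by honest steps -/

theorem exists_mem_notMem {S B : Finset P} (h : B.card < S.card) : ∃ k ∈ S, k ∉ B :=
  Finset.exists_mem_notMem_of_card_lt_card h

/-- A valid certificate whose honest votes have been sent witnesses a quorum of Prepare messages. -/
theorem Certificate.Valid.prepareQuorum {c : Certificate P D} (hc : c.Valid cfg)
    (hB : B.card ≤ cfg.f)
    (hq : ∀ k ∉ B, ∀ v sq δ, Msg.vote ⟨.commit, k, v, sq, δ⟩ ∈ sent →
      PrepareQuorum cfg B sent v sq δ)
    (hv : ∀ k ∈ c.signers, k ∉ B → Msg.vote ⟨c.phase, k, c.view, c.sq, c.digest⟩ ∈ sent) :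
    PrepareQuorum cfg B sent c.view c.sq c.digest := by
  obtain ⟨ph, v, sq, δ, S⟩ := c
  cases ph with
  | prepare => exact ⟨S, hc, hv⟩
  | commit =>
    obtain ⟨k, hk, hkB⟩ := exists_mem_notMem (S := S) (B := B) (by
      have : cfg.f + 1 ≤ S.card := hc
      omega)
    exact hq k hkB _ _ _ (hv k hk hkB)

/-- The invariant of `i` alone is not enough: a Commit triggered by `f + 1` Commits inherits its
Prepare quorum from an honest signer among them, hence `hq`. -/
theorem HonestStep.localInv {i : P} {l l' : LocalState P R D} {out : Set (Msg P R D)}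
    (h : HonestStep cfg i l l' out) (hB : B.card ≤ cfg.f)
    (hq : ∀ k ∉ B, ∀ v sq δ, Msg.vote ⟨.commit, k, v, sq, δ⟩ ∈ sent →
      PrepareQuorum cfg B sent v sq δ)
    (hl : LocalInv cfg B sent i l) : LocalInv cfg B (sent ∪ out) i l' := by
  classical
  have hs : sent ⊆ sent ∪ out := Set.subset_union_left
  cases h with
  | broadcastUpdate => exact hl.send (by simp) (by simp)
  | prePropose => exact hl.send (by simp) (by simp)
  | prePrepare => exact hl.send (by simp) (by simp)
  | announceNewView => exact hl.send (by simp) (by simp)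
  | prepare m hact hrec hval hview hnone =>
    have hc : ∀ v sq δ, Msg.vote ⟨.commit, i, v, sq, δ⟩ ∈
        sent ∪ {Msg.vote ⟨.prepare, i, l.view, m.sq, m.digest⟩} →
        Msg.vote ⟨.commit, i, v, sq, δ⟩ ∈ sent := by simp
    refine
    { received_sent := hl.received_sent.trans hs
      certs_held := hl.certs_held
      prepare_accepted := ?_
      prepare_announced := ?_
      prepare_origin := ?_
      active_announced := ?_
      commit_quorum := fun v sq δ hm => (hl.commit_quorum v sq δ (hc _ _ _ hm)).mono hs
      commit_certified := fun v sq δ hm => hl.commit_certified v sq δ (hc _ _ _ hm)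
      viewChange_reports := ?_
      committed_quorum := fun v sq b hb => (hl.committed_quorum v sq b hb).mono hs }
    · rintro v sq δ (hm | hm)
      · obtain ⟨h1, h2, h3⟩ := hl.prepare_accepted v sq δ hm
        refine ⟨h1, h2, ?_⟩
        -- The overwritten entry was `none`, whereas an earlier Prepare would have left a digest
        -- there.
        by_cases he : v = l.view ∧ sq = m.sq
        · obtain ⟨rfl, rfl⟩ := he
          simp [hnone] at h3
        · simpa [he] using h3
      · simp only [Set.mem_singleton_iff, Msg.vote.injEq, Vote.mk.injEq, true_and] at hm
        obtain ⟨rfl, rfl, rfl⟩ := hm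
        exact ⟨le_rfl, fun _ => hact, by simp⟩
    · rintro v sq δ (hm | hm) hv
      · exact (hl.prepare_announced v sq δ hm hv).mono hs
      · simp only [Set.mem_singleton_iff, Msg.vote.injEq, Vote.mk.injEq, true_and] at hm
        obtain ⟨rfl, rfl, rfl⟩ := hm
        obtain ⟨n, hn, hnv, hnw, hO⟩ := hl.active_announced hact hv
        refine ⟨n, hs hn, hnv, hnw, fun δ' hδ' => ?_⟩
        -- An entry of the list at `m.sq` would still be recorded in `accepted`, against `hnone`.
        simpa [hnone] using hO _ _ hδ'
    · rintro v sq δ (hm | hm)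
      · exact (hl.prepare_origin v sq δ hm).imp_right fun a => a.mono hs
      · simp only [Set.mem_singleton_iff, Msg.vote.injEq, Vote.mk.injEq, true_and] at hm
        obtain ⟨rfl, rfl, rfl⟩ := hm
        exact Or.inl ⟨m.raw, hview ▸ hval.2.1, hval.2.2⟩
    · intro _ hv
      obtain ⟨n, hn, hnv, hnw, hO⟩ := hl.active_announced hact hv
      refine ⟨n, hs hn, hnv, hnw, fun sq δ hδ => ?_⟩
      have h3 := hO _ _ hδ
      by_cases he : sq = m.sq
      · subst he
        simp [hnone] at h3
      · simpa [he] using h3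
    · intro w C hm
      obtain ⟨h1, h2⟩ := hl.viewChange_reports w C (by simpa using hm)
      exact ⟨h1, fun v sq δ hm' => h2 v sq δ (hc _ _ _ hm')⟩
  | commit c hact hview hval hheld =>
    have hp : ∀ v sq δ, Msg.vote ⟨.prepare, i, v, sq, δ⟩ ∈
        sent ∪ {Msg.vote ⟨.commit, i, l.view, c.sq, c.digest⟩} →
        Msg.vote ⟨.prepare, i, v, sq, δ⟩ ∈ sent := by simp
    refine
    { received_sent := hl.received_sent.trans hs
      certs_held := ?_
      prepare_accepted := fun v sq δ hm => hl.prepare_accepted v sq δ (hp _ _ _ hm)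
      prepare_announced := fun v sq δ hm hv =>
        (hl.prepare_announced v sq δ (hp _ _ _ hm) hv).mono hs
      prepare_origin := fun v sq δ hm =>
        (hl.prepare_origin v sq δ (hp _ _ _ hm)).imp_right fun a => a.mono hs
      active_announced := fun ha hv => (hl.active_announced ha hv).mono hs
      commit_quorum := ?_
      commit_certified := ?_
      viewChange_reports := ?_
      committed_quorum := fun v sq b hb => (hl.committed_quorum v sq b hb).mono hs }
    · intro d hd
      rcases Finset.mem_insert.1 hd with rfl | hd
      exacts [hheld, hl.certs_held d hd]
    · rintro v sq δ (hm | hm)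
      · exact (hl.commit_quorum v sq δ hm).mono hs
      · simp only [Set.mem_singleton_iff, Msg.vote.injEq, Vote.mk.injEq, true_and] at hm
        obtain ⟨rfl, rfl, rfl⟩ := hm
        have hpq := hval.prepareQuorum hB hq fun k hk _ =>
          hl.received_sent (hheld _ ⟨k, hk, rfl⟩)
        rw [hview] at hpq
        exact hpq.mono hs
    · rintro v sq δ (hm | hm)
      · obtain ⟨h1, d, hd, h2⟩ := hl.commit_certified v sq δ hm
        exact ⟨h1, d, Finset.mem_insert_of_mem hd, h2⟩
      · simp only [Set.mem_singleton_iff, Msg.vote.injEq, Vote.mk.injEq, true_and] at hm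
        obtain ⟨rfl, rfl, rfl⟩ := hm
        exact ⟨le_rfl, c, Finset.mem_insert_self _ _, hview, rfl, rfl⟩
    · intro w C hm
      obtain ⟨h1, h2⟩ := hl.viewChange_reports w C (by simpa using hm)
      refine ⟨h1, ?_⟩
      rintro v sq δ (hm' | hm') hlt
      · exact h2 v sq δ hm' hlt
      · simp only [Set.mem_singleton_iff, Msg.vote.injEq, Vote.mk.injEq, true_and] at hm'
        obtain ⟨rfl, rfl, rfl⟩ := hm'
        -- The new Commit belongs to the current view, which is at least `w` once a View-change for
        -- `w` has been sent; old reports stay complete.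
        exact absurd h1 hlt.not_ge
  | commitLocal c b hview hphase hcard hheld hb =>
    rw [Set.union_empty]
    refine { hl with certs_held := ?_, commit_certified := ?_, committed_quorum := ?_ }
    · intro d hd
      rcases Finset.mem_insert.1 hd with rfl | hd
      exacts [hheld, hl.certs_held d hd]
    · intro v sq δ hm
      obtain ⟨h1, d, hd, h2⟩ := hl.commit_certified v sq δ hm
      exact ⟨h1, d, Finset.mem_insert_of_mem hd, h2⟩
    · rintro v sq b' (hb' | hb')
      · simp only [Prod.mk.injEq] at hb'
        obtain ⟨rfl, rfl, rfl⟩ := hb'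
        rw [hb]
        exact ⟨c.signers, hcard, fun k hk =>
          hl.received_sent (hheld _ ⟨k, hk, by rw [hphase]⟩)⟩
      · exact hl.committed_quorum v sq b' hb'
  | viewChange v₀ hlt =>
    have hv : ∀ y, Msg.vote y ∈ sent ∪ {Msg.viewChange ⟨i, v₀, l.certs⟩} →
        Msg.vote y ∈ sent := by simp
    refine
    { received_sent := hl.received_sent.trans hs
      certs_held := hl.certs_held
      prepare_accepted := ?_
      prepare_announced := fun v sq δ hm hv' =>
        (hl.prepare_announced v sq δ (hv _ hm) hv').mono hs
      prepare_origin := fun v sq δ hm =>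
        (hl.prepare_origin v sq δ (hv _ hm)).imp_right fun a => a.mono hs
      active_announced := by simp
      commit_quorum := fun v sq δ hm => (hl.commit_quorum v sq δ (hv _ hm)).mono hs
      commit_certified := ?_
      viewChange_reports := ?_
      committed_quorum := fun v sq b hb => (hl.committed_quorum v sq b hb).mono hs }
    · intro v sq δ hm
      obtain ⟨h1, -, h3⟩ := hl.prepare_accepted v sq δ (hv _ hm)
      exact ⟨h1.trans hlt.le, fun e => absurd (e.symm.trans_le h1) hlt.not_ge, h3⟩
    · intro v sq δ hm
      obtain ⟨h1, h2⟩ := hl.commit_certified v sq δ (hv _ hm)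
      exact ⟨h1.trans hlt.le, h2⟩
    · rintro w C (hm | hm)
      · obtain ⟨h1, h2⟩ := hl.viewChange_reports w C hm
        exact ⟨h1.trans hlt.le, fun v sq δ hm' => h2 v sq δ (hv _ hm')⟩
      · simp only [Set.mem_singleton_iff, Msg.viewChange.injEq, ViewChange.mk.injEq,
          true_and] at hm
        obtain ⟨rfl, rfl⟩ := hm
        exact ⟨le_rfl, fun v sq δ hm' _ => (hl.commit_certified v sq δ (hv _ hm')).2⟩
  | enterNewView m hrec hval hview =>
    have hle : l.view ≤ m.view := by omega
    -- Before entering, the participant is below `m.view` or inactive in it, so no Prepare of its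
    -- own is contradicted by the new digests.
    have hnew : ∀ v sq δ, Msg.vote ⟨.prepare, i, v, sq, δ⟩ ∈ sent → v ≠ m.view := by
      rintro v sq δ hm rfl
      obtain ⟨h1, h2, -⟩ := hl.prepare_accepted _ sq δ hm
      rcases hview with h | ⟨h, h'⟩
      · omega
      · simp [h2 h.symm] at h'
    have hsent : Msg.newView m ∈ sent := hl.received_sent hrec
    set out : Set (Msg P R D) :=
      {x | ∃ sq δ, m.O[sq]? = some δ ∧ x = .vote ⟨.prepare, i, m.view, sq, δ⟩} with hout
    have hp : ∀ v sq δ, Msg.vote ⟨.prepare, i, v, sq, δ⟩ ∈ out →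
        v = m.view ∧ m.O[sq]? = some δ := by
      rintro v sq δ ⟨sq', δ', hO, he⟩
      simp only [Msg.vote.injEq, Vote.mk.injEq, true_and] at he
      obtain ⟨rfl, rfl, rfl⟩ := he
      exact ⟨rfl, hO⟩
    have hc : ∀ v sq δ, Msg.vote ⟨.commit, i, v, sq, δ⟩ ∈ sent ∪ out →
        Msg.vote ⟨.commit, i, v, sq, δ⟩ ∈ sent := by simp [hout]
    refine
    { received_sent := hl.received_sent.trans hs
      certs_held := hl.certs_held
      prepare_accepted := ?_
      prepare_announced := ?_
      prepare_origin := ?_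
      active_announced := fun _ _ => ⟨m, hs hsent, hval, rfl, by simp⟩
      commit_quorum := fun v sq δ hm => (hl.commit_quorum v sq δ (hc _ _ _ hm)).mono hs
      commit_certified := ?_
      viewChange_reports := ?_
      committed_quorum := fun v sq b hb => (hl.committed_quorum v sq b hb).mono hs }
    · rintro v sq δ (hm | hm)
      · obtain ⟨h1, -, h3⟩ := hl.prepare_accepted v sq δ hm
        exact ⟨h1.trans hle, fun _ => rfl, by simpa [hnew v sq δ hm] using h3⟩
      · obtain ⟨rfl, hO⟩ := hp v sq δ hm
        exact ⟨le_rfl, fun _ => rfl, by simpa using hO⟩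
    · rintro v sq δ (hm | hm) hv
      · exact (hl.prepare_announced v sq δ hm hv).mono hs
      · obtain ⟨rfl, hO⟩ := hp v sq δ hm
        exact ⟨m, hs hsent, hval, rfl, fun δ' hδ' => Option.some.inj (hδ'.symm.trans hO)⟩
    · rintro v sq δ (hm | hm)
      · exact (hl.prepare_origin v sq δ hm).imp_right fun a => a.mono hs
      · obtain ⟨rfl, hO⟩ := hp v sq δ hm
        exact Or.inr ⟨m, hs hsent, hval, rfl, hO⟩
    · intro v sq δ hm
      obtain ⟨h1, h2⟩ := hl.commit_certified v sq δ (hc _ _ _ hm)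
      exact ⟨h1.trans hle, h2⟩
    · intro w C hm
      obtain ⟨h1, h2⟩ := hl.viewChange_reports w C (by simpa [hout] using hm)
      exact ⟨h1.trans hle, fun v sq δ hm' => h2 v sq δ (hc _ _ _ hm')⟩

/-! ### Unforgeability and the global invariant -/

/-- Whatever an honest participant passes on it has received, so it was sent; deeper nesting is
covered by `Unforged` for the received message. -/
theorem HonestStep.embedded_sent {i : P} {l l' : LocalState P R D} {out : Set (Msg P R D)}
    (h : HonestStep cfg i l l' out) (hl : LocalInv cfg B sent i l) (hu : Unforged B sent) :
    ∀ m ∈ out, ∀ x ∈ m.embedded, x.sender ∉ B → x ∈ sent := by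
  cases h with
  | broadcastUpdate => simp [Msg.embedded]
  | prePropose sq prop _ hrec =>
    rintro _ rfl _ ⟨r, hr, rfl⟩ -
    exact hl.received_sent (hrec r hr)
  | prePrepare sq raw _ _ hrec =>
    rintro _ rfl _ ⟨p, hp, rfl | ⟨r, hr, rfl⟩⟩ hx
    · exact hl.received_sent (hrec p hp)
    · exact hu _ (hl.received_sent (hrec p hp)) _ ⟨r, hr, rfl⟩ hx
  | prepare => simp [Msg.embedded]
  | commit => simp [Msg.embedded]
  | commitLocal => simp
  | viewChange =>
    rintro _ rfl _ ⟨c, hc, y, hy, rfl⟩ -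
    exact hl.received_sent (hl.certs_held c hc y hy)
  | announceNewView V O _ _ hrec =>
    rintro _ rfl _ ⟨w, hw, rfl | ⟨c, hc, y, hy, rfl⟩⟩ hx
    · exact hl.received_sent (hrec w hw)
    · exact hu _ (hl.received_sent (hrec w hw)) _ ⟨c, hc, y, hy, rfl⟩ hx
  | enterNewView =>
    rintro _ ⟨_, _, _, rfl⟩
    simp [Msg.embedded]

/-- The invariant of the protocol. -/
structure Inv (cfg : Config P R D) (B : Finset P) (s : State P R D) : Prop where
  unforged : Unforged B s.sent
  localInv : ∀ i ∉ B, LocalInv cfg B s.sent i (s.loc i)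

theorem Step.inv {s s' : State P R D} (h : Step cfg B s s') (hB : B.card ≤ cfg.f)
    (hs : Inv cfg B s) : Inv cfg B s' := by
  classical
  cases h with
  | honest i l out hi hstep =>
    refine ⟨?_, fun k hk => ?_⟩
    · rintro m (hm | hm) x hx hxB
      · exact Or.inl (hs.unforged m hm x hx hxB)
      · exact Or.inl (hstep.embedded_sent (hs.localInv i hi) hs.unforged m hm x hx hxB)
    · by_cases hki : k = i
      · subst hki
        simpa using hstep.localInv hB (fun k hk => (hs.localInv k hk).commit_quorum)
          (hs.localInv k hi)
      · simp only [Function.update_of_ne hki]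
        refine (hs.localInv k hk).mono Set.subset_union_left ?_
        rintro m (hm | hm) rfl
        · exact hm
        · exact absurd (hstep.sender_eq m hm) hki
  | deliver i m hm =>
    refine ⟨hs.unforged, fun k hk => ?_⟩
    by_cases hki : k = i
    · subst hki
      simpa using (hs.localInv k hk).deliver hm
    · simpa only [Function.update_of_ne hki] using hs.localInv k hk
  | byzantine m hm hx =>
    refine ⟨?_, fun k hk => (hs.localInv k hk).mono (Set.subset_insert _ _) ?_⟩
    · rintro n (rfl | hn) x hxn hxB
      · exact Or.inr (hx x hxn hxB)
      · exact Or.inr (hs.unforged n hn x hxn hxB)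
    · rintro n (rfl | hn) rfl
      · exact absurd hm hk
      · exact hn

theorem Reachable.inv {s : State P R D} (h : Reachable cfg B s) (hB : B.card ≤ cfg.f) :
    Inv cfg B s := by
  induction h with
  | refl => exact ⟨by simp [Unforged, State.init], fun i _ => LocalInv.init cfg B i⟩
  | tail _ hstep ih => exact hstep.inv hB ih

/-! ### Quorum intersection -/

/-- The intersection has at least `2(2f + 1) - (3f + 1) = f + 1` members, more than `B`. -/
theorem exists_honest_mem_inter [Fintype P] (hn : Fintype.card P = 3 * cfg.f + 1)
    (hB : B.card ≤ cfg.f) {S T : Finset P} (hS : 2 * cfg.f + 1 ≤ S.card)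
    (hT : 2 * cfg.f + 1 ≤ T.card) : ∃ k ∈ S, k ∈ T ∧ k ∉ B := by
  classical
  have h1 := Finset.card_union_add_card_inter S T
  have h2 := Finset.card_le_univ (S ∪ T)
  obtain ⟨k, hk, hkB⟩ := exists_mem_notMem (S := S ∩ T) (B := B) (by omega)
  exact ⟨k, (Finset.mem_inter.1 hk).1, (Finset.mem_inter.1 hk).2, hkB⟩

theorem PrepareQuorum.exists_honest {v sq : ℕ} {δ : D} (h : PrepareQuorum cfg B sent v sq δ)
    (hB : B.card ≤ cfg.f) : ∃ k ∉ B, Msg.vote ⟨.prepare, k, v, sq, δ⟩ ∈ sent := by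
  obtain ⟨S, hS, h⟩ := h
  obtain ⟨k, hk, hkB⟩ := exists_mem_notMem (S := S) (B := B) (by omega)
  exact ⟨k, hkB, h k hk hkB⟩

variable {s : State P R D}

theorem Inv.commitQuorum_prepareQuorum (hs : Inv cfg B s) (hB : B.card ≤ cfg.f) {v sq : ℕ} {δ : D}
    (h : CommitQuorum cfg s.sent v sq δ) : PrepareQuorum cfg B s.sent v sq δ := by
  obtain ⟨S, hS, h⟩ := h
  obtain ⟨k, hk, hkB⟩ := exists_mem_notMem (S := S) (B := B) (by omega)
  exact (hs.localInv k hkB).commit_quorum _ _ _ (h k hk)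

/-- A common honest voter has a single entry in `accepted`. -/
theorem Inv.prepareQuorum_unique [Fintype P] (hn : Fintype.card P = 3 * cfg.f + 1)
    (hs : Inv cfg B s) (hB : B.card ≤ cfg.f) {v sq : ℕ} {δ δ' : D}
    (h : PrepareQuorum cfg B s.sent v sq δ) (h' : PrepareQuorum cfg B s.sent v sq δ') :
    δ = δ' := by
  obtain ⟨S, hS, h⟩ := h
  obtain ⟨T, hT, h'⟩ := h'
  obtain ⟨k, hkS, hkT, hkB⟩ := exists_honest_mem_inter hn hB hS hT
  have h1 := ((hs.localInv k hkB).prepare_accepted _ _ _ (h k hkS hkB)).2.2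
  have h2 := ((hs.localInv k hkB).prepare_accepted _ _ _ (h' k hkT hkB)).2.2
  exact Option.some.inj (h1.symm.trans h2)

/-! ### Agreement across views -/

/-- A certificate reported in a valid New-view message stems from an earlier view and witnesses a
quorum of Prepare messages. -/
theorem Inv.reported (hs : Inv cfg B s) (hB : B.card ≤ cfg.f) {m : NewView P D}
    (hm : Msg.newView m ∈ s.sent) (hval : m.Valid cfg) {c : Certificate P D}
    (hc : Reported m.V c) :
    c.view < m.view ∧ PrepareQuorum cfg B s.sent c.view c.sq c.digest := by
  obtain ⟨w, hw, hcw⟩ := hc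
  obtain ⟨hwv, hwm⟩ := hval.2.1.1 w hw
  obtain ⟨hcv, hlt⟩ := hwv c hcw
  refine ⟨hwm ▸ hlt, hcv.prepareQuorum hB (fun k hk => (hs.localInv k hk).commit_quorum)
    fun k hk hkB => ?_⟩
  -- Byzantine votes may exist only inside `m`, never sent on their own; this is why `PrepareQuorum`
  -- constrains honest members only.
  exact hs.unforged _ hm _ ⟨w, hw, Or.inr ⟨c, hcw, _, ⟨k, hk, rfl⟩, rfl⟩⟩ hkB

/-- Every valid New-view message for a later view reports a certificate for a digest on which a
quorum has sent Commit messages. -/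
theorem Inv.exists_reported [Fintype P] (hn : Fintype.card P = 3 * cfg.f + 1)
    (hs : Inv cfg B s) (hB : B.card ≤ cfg.f) {v sq : ℕ} {δ : D}
    (h : CommitQuorum cfg s.sent v sq δ) {m : NewView P D} (hm : Msg.newView m ∈ s.sent)
    (hval : m.Valid cfg) (hlt : v < m.view) :
    ∃ c, Reported m.V c ∧ c.view = v ∧ c.sq = sq ∧ c.digest = δ := by
  classical
  obtain ⟨S, hS, h⟩ := h
  obtain ⟨hV, hinj, hcard⟩ := hval.2.1
  obtain ⟨k, hkS, hkV, hkB⟩ := exists_honest_mem_inter (T := m.V.image ViewChange.sender) hn hB hS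
    (by rwa [Finset.card_image_of_injOn hinj])
  obtain ⟨⟨k, w, C⟩, hw, rfl⟩ := Finset.mem_image.1 hkV
  have hsent : Msg.viewChange ⟨k, w, C⟩ ∈ s.sent := hs.unforged _ hm _ ⟨_, hw, Or.inl rfl⟩ hkB
  obtain rfl : w = m.view := (hV _ hw).2
  obtain ⟨c, hc, h'⟩ :=
    ((hs.localInv k hkB).viewChange_reports _ C hsent).2 v sq δ (h k hkS) hlt
  exact ⟨c, ⟨_, hw, hc⟩, h'⟩

/-- Once a quorum has sent Commit messages for a digest, no other digest can gather a quorum of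
Prepare messages in this or a later view. -/
theorem Inv.digest_eq_of_le [Fintype P] (hn : Fintype.card P = 3 * cfg.f + 1)
    (hs : Inv cfg B s) (hB : B.card ≤ cfg.f) {v sq : ℕ} {δ : D}
    (h : CommitQuorum cfg s.sent v sq δ) (w : ℕ) (hvw : v ≤ w) (δ' : D)
    (h' : PrepareQuorum cfg B s.sent w sq δ') : δ' = δ := by
  induction w using Nat.strong_induction_on generalizing δ' with
  | _ w ih =>
    rcases hvw.eq_or_lt with rfl | hlt
    · exact hs.prepareQuorum_unique hn hB h' (hs.commitQuorum_prepareQuorum hB h)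
    obtain ⟨k, hkB, hk⟩ := h'.exists_honest hB
    obtain ⟨m, hm, hval, rfl, hO⟩ :=
      (hs.localInv k hkB).prepare_announced w sq δ' hk (by omega)
    obtain ⟨c₀, hc₀, hv, hsq, -⟩ := hs.exists_reported hn hB h hm hval hlt
    obtain ⟨hlen, hcarry⟩ := hval.2.2
    -- The report `c₀` forces the list to reach `sq`, so `δ'` must be its entry there and cannot
    -- stem from a differing Pre-Prepare.
    have hget := List.getElem?_eq_getElem ((hlen sq).2 ⟨c₀, hc₀, hsq.ge⟩)
    rw [← hO _ hget]
    rcases hcarry sq _ hget with ⟨c, hc, hcsq, hcd, hmax⟩ | ⟨hno, -⟩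
    · obtain ⟨hcv, hq⟩ := hs.reported hB hm hval hc
      rw [hcsq, hcd] at hq
      -- Maximality against `c₀` gives `v ≤ c.view`; validity of the View-change message gave
      -- `c.view < m.view`.
      exact ih c.view hcv (hv ▸ hmax c₀ hc₀ hsq) _ hq
    · exact absurd hsq (hno c₀ hc₀)

/-! ### Sequence numbers of requests -/

theorem sq_eq_of_mem_aggregate {v sq : ℕ} {raw : Finset (PrePropose P R)}
    (h : ValidRaw cfg v sq raw) {r : Request P R} (hr : r ∈ aggregate cfg.f raw) : r.sq = sq := by
  classical
  simp only [aggregate, Finset.mem_filter, Finset.mem_biUnion] at hr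
  obtain ⟨⟨p, hp, hrp⟩, -⟩ := hr
  obtain ⟨hpv, -, hpsq⟩ := h.1 p hp
  exact (hpv.1 r hrp).2.trans hpsq

/-- If `h` has no collisions, then a batch whose digest an honest participant prepares with a
sequence number holds only requests with this sequence number. -/
theorem Inv.sq_eq_of_prepared (hs : Inv cfg B s) (hB : B.card ≤ cfg.f)
    (hinj : Function.Injective cfg.h) {sq : ℕ} {b : Batch P R} {r : Request P R} (hr : r ∈ b)
    (v : ℕ) (k : P) (hk : k ∉ B)
    (h : Msg.vote ⟨.prepare, k, v, sq, cfg.h b⟩ ∈ s.sent) : r.sq = sq := by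
  induction v using Nat.strong_induction_on generalizing k with
  | _ v ih =>
    rcases (hs.localInv k hk).prepare_origin _ _ _ h with
      ⟨raw, hraw, he⟩ | ⟨m, hm, hval, rfl, hO⟩
    · exact sq_eq_of_mem_aggregate hraw (hinj he ▸ hr)
    rcases hval.2.2.2 sq _ hO with ⟨c, hc, hcsq, hcd, -⟩ | ⟨-, he⟩
    · obtain ⟨hcv, hq⟩ := hs.reported hB hm hval hc
      rw [hcsq, hcd] at hq
      obtain ⟨k', hk', h'⟩ := hq.exists_honest hB
      exact ih c.view hcv k' hk' h'
    · rw [hinj he] at hr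
      simp at hr

end Safety

end EByFTVeS

theorem mainTheorem1 {P R D : Type*} [Fintype P]
    (cfg : EByFTVeS.Config P R D) (hn : Fintype.card P = 3 * cfg.f + 1)
    (B : Finset P) (hB : B.card ≤ cfg.f)
    (s : EByFTVeS.State P R D) (hs : EByFTVeS.Reachable cfg B s)
    (i j : P) (hi : i ∉ B) (hj : j ∉ B) :
    (∀ (v v' sq : ℕ) (b b' : EByFTVeS.Batch P R),
      s.CommittedLocal i v sq b → s.CommittedLocal j v' sq b' → cfg.h b = cfg.h b') ∧
    (Function.Injective cfg.h →
      (∀ (v v' sq : ℕ) (b b' : EByFTVeS.Batch P R),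
        s.CommittedLocal i v sq b → s.CommittedLocal j v' sq b' → b = b') ∧
      (∀ (v v' sq sq' : ℕ) (b b' : EByFTVeS.Batch P R) (r : EByFTVeS.Request P R),
        s.CommittedLocal i v sq b → r ∈ b →
        s.CommittedLocal j v' sq' b' → r ∈ b' → sq = sq')) := by
  have hinv := hs.inv hB
  have hagree : ∀ (v v' sq : ℕ) (b b' : EByFTVeS.Batch P R),
      s.CommittedLocal i v sq b → s.CommittedLocal j v' sq b' → cfg.h b = cfg.h b' := by
    intro v v' sq b b' hb hb'
    have hq := (hinv.localInv i hi).committed_quorum _ _ _ hb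
    have hq' := (hinv.localInv j hj).committed_quorum _ _ _ hb'
    -- The commit of the earlier view acts as the Commit quorum; the later one is needed only
    -- through its Prepare quorum.
    rcases le_total v v' with hle | hle
    · exact (hinv.digest_eq_of_le hn hB hq v' hle _
        (hinv.commitQuorum_prepareQuorum hB hq')).symm
    · exact hinv.digest_eq_of_le hn hB hq' v hle _ (hinv.commitQuorum_prepareQuorum hB hq)
  have hsq : Function.Injective cfg.h → ∀ k ∉ B, ∀ (v sq : ℕ) (b : EByFTVeS.Batch P R)
      (r : EByFTVeS.Request P R), s.CommittedLocal k v sq b → r ∈ b → r.sq = sq := by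
    intro hinj k hk v sq b r hb hr
    obtain ⟨k', hk', h'⟩ := (hinv.commitQuorum_prepareQuorum hB
      ((hinv.localInv k hk).committed_quorum _ _ _ hb)).exists_honest hB
    exact hinv.sq_eq_of_prepared hB hinj hr v k' hk' h'
  refine ⟨hagree, fun hinj => ⟨fun v v' sq b b' hb hb' => hinj (hagree v v' sq b b' hb hb'), ?_⟩⟩
  intro v v' sq sq' b b' r hb hr hb' hr'
  exact (hsq hinj i hi v sq b r hb hr).symm.trans (hsq hinj j hj v' sq' b' r hb' hr')
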